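/- Let $p,d\ge 1$ be integers, $\beta>2$, $s=\lfloor\beta\rfloor$ and $\delta=\beta-s$. For $g\in\mathcal C^k([0,1]^d,\mathbb R^p)$ put $$\|g\|_{\mathcal C^k}=\max_{|\gamma|\le k}\ \max_{1\le m\le p}\ \sup_{x\in[0,1]^d}|D^\gamma g_m(x)|,$$ and for $H>0$ let $\mathcal H^\beta_p([0,1]^d,H)$ be the set of all $f\in\mathcal C^s([0,1]^d,\mathbb R^p)$ with $$\max\Big(\|f\|_{\mathcal C^s},\ \max_{|\gamma|=s}\ \max_{1\le m\le p}\ \sup_{x\ne y\in[0,1]^d}\frac{|D^\gamma f_m(x)-D^\gamma f_m(y)|}{\min(1,\|x-y\|)^{\delta}}\Big)\le H .$$ A rational function on $\mathbb R^n$ is a quotient $r=P/Q$ of coprime real polynomials in $n$ variables with $P\neq0$ and $Q(z)>0$ for all $z\in\mathbb R^n$; its degree is the larger of the total degrees of $P$ and $Q$. A rational neural network of depth $L\ge1$ with layer dimensions $n_0,\dots,n_L\ge1$ is a composition $\mathcal R_L\circ\dots\circ\mathcal R_1$ of maps $\mathcal R_i:\mathbb R^{n_{i-1}}\to\mathbb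 R^{n_i}$ all of whose components (the activations) are rational functions; its width is $\max_{0\le l\le L}n_l$. **Theorem.** For every $\epsilon>0$ there is a constant $C>0$, depending only on $\beta,p,d,\epsilon$, such that the following holds. For every $H>0$ and every $f\in\mathcal H^\beta_p([0,1]^d,H)$ there are a constant $c>0$ and rational neural networks $\mathcal R_N$, $N=1,2,3,\dots$, with input dimension $d$ and output dimension $p$, such that for every $N\ge1$ the network $\mathcal R_N$ has width at most $CN$, depth exactly $\lfloor\beta\rfloor+2$, activations of degree at most $CN^{\epsilon}$, and $$\|f-\mathcal R_N\|_{\mathcal C^1([0,1]^d)}\le c\,N^{-(\beta-1)} .$$ -/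

import Mathlib

open scoped ENNReal

/-- The closed unit cube `[0,1]^d`. -/
def unitCube (d : ℕ) : Set (Fin d → ℝ) := Set.Icc 0 1

/-- The partial derivative `∂_{i 0} ⋯ ∂_{i (k-1)} g` of order `k`, taken on the unit cube.
The derivatives `D^γ g` with `|γ| = k` are exactly these, with `γ` counting how often each
index occurs in `i`. -/
noncomputable def partialDeriv {d p k : ℕ} (i : Fin k → Fin d)
    (g : (Fin d → ℝ) → (Fin p → ℝ)) (x : Fin d → ℝ) : Fin p → ℝ :=
  iteratedFDerivWithin ℝ k g (unitCube d) x (fun a => Pi.single (i a) 1)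

/-- The norm of `C^s([0,1]^d, ℝ^p)`: the maximum over all multi-indices `|γ| ≤ s` and all
components of the supremum of `|D^γ g|` over the cube, with value `∞` if it is not finite. -/
noncomputable def cNorm {d p : ℕ} (s : ℕ) (g : (Fin d → ℝ) → (Fin p → ℝ)) : ℝ≥0∞ :=
  ⨆ k ∈ Set.Iic s, ⨆ i : Fin k → Fin d, ⨆ x ∈ unitCube d, ⨆ m : Fin p,
    ENNReal.ofReal |partialDeriv i g x m|

/-- The Hölder constant `[g]_δ` on the cube, with Euclidean distance between points. -/
noncomputable def holderConst {d p : ℕ} (δ : ℝ) (g : (Fin d → ℝ) → (Fin p → ℝ)) : ℝ≥0∞ :=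
  ⨆ m : Fin p, ⨆ x ∈ unitCube d, ⨆ y ∈ unitCube d, ⨆ _ : x ≠ y,
    ENNReal.ofReal (|g x m - g y m| / (min 1 ‖WithLp.toLp 2 (x - y)‖) ^ δ)

/-- The Hölder norm of order `β`: the maximum of the `C^s` norm and of the Hölder constants
`[D^γ f]_{β-s}`, `|γ| = s`, where `s = ⌊β⌋`. -/
noncomputable def holderNorm {d p : ℕ} (β : ℝ) (f : (Fin d → ℝ) → (Fin p → ℝ)) : ℝ≥0∞ :=
  max (cNorm ⌊β⌋₊ f)
    (⨆ i : Fin ⌊β⌋₊ → Fin d, holderConst (β - (⌊β⌋₊ : ℝ)) (partialDeriv i f))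

/-- The Hölder ball of radius `H`. Only the values of `f` on the cube matter. -/
def holderBall (d p : ℕ) (β H : ℝ) : Set ((Fin d → ℝ) → (Fin p → ℝ)) :=
  {f | ContDiffOn ℝ (⌊β⌋₊ : ℕ) f (unitCube d) ∧ holderNorm β f ≤ ENNReal.ofReal H}

/-- A rational function of `n` real variables: a quotient of polynomials in lowest terms whose
numerator is not the zero polynomial and whose denominator is positive everywhere. Lowest terms
means that all common divisors are constants (`IsRelPrime`; a Bézout identity is not required). -/
structure RationalFunction (n : ℕ) where
  num : MvPolynomial (Fin n) ℝ
  den : MvPolynomial (Fin n) ℝ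
  num_ne_zero : num ≠ 0
  den_pos : ∀ z : Fin n → ℝ, 0 < MvPolynomial.eval z den
  coprime : IsRelPrime num den

namespace RationalFunction

/-- The function `z ↦ num z / den z`. -/
noncomputable def eval {n : ℕ} (r : RationalFunction n) (z : Fin n → ℝ) : ℝ :=
  MvPolynomial.eval z r.num / MvPolynomial.eval z r.den

/-- The larger of the total degrees of numerator and denominator. -/
noncomputable def degree {n : ℕ} (r : RationalFunction n) : ℕ :=
  max r.num.totalDegree r.den.totalDegree

end RationalFunction

/-- A rational neural network with input dimension `m` and output dimension `n`: either one layer,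
given by the rational activation of each of its `n` neurons, or a network followed by one more
layer. The dimension of every hidden layer is positive. -/
inductive RationalNetwork (m : ℕ) : ℕ → Type
  | layer {n : ℕ} (r : Fin n → RationalFunction m) : RationalNetwork m n
  | comp {k n : ℕ} (hk : 0 < k) (R : RationalNetwork m k) (r : Fin n → RationalFunction k) :
      RationalNetwork m n

namespace RationalNetwork

/-- The function realized by a network. -/
noncomputable def eval {m n : ℕ} (R : RationalNetwork m n) : (Fin m → ℝ) → (Fin n → ℝ) :=
  match R with
  | layer r => fun z j => (r j).eval z
  | comp _ R r => fun z j => (r j).eval (R.eval z)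

/-- The number of layers. -/
def depth {m n : ℕ} (R : RationalNetwork m n) : ℕ :=
  match R with
  | layer _ => 1
  | comp _ R _ => R.depth + 1

/-- The largest dimension, input and output included. -/
def width {m n : ℕ} (R : RationalNetwork m n) : ℕ :=
  match R with
  | layer _ => max m n
  | comp _ R _ => max R.width n

/-- The largest degree of a rational activation in the network. -/
noncomputable def degree {m n : ℕ} (R : RationalNetwork m n) : ℕ :=
  match R with
  | layer r => Finset.univ.sup fun j => (r j).degree
  | comp _ R r => max R.degree (Finset.univ.sup fun j => (r j).degree)

end RationalNetwork

/-!
The approximant is a quotient `F = (∑ i, W i * T i) / ∑ i, W i`. Here `i` runs over the regular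
grid `{0, …, N}^d`, `T i` is the Taylor polynomial of `f` of order `s = ⌊β⌋` at `i / N`, and
`W i x = ∏ j, (1 + (N * x j - i j) ^ 2) ^ (-2 * K)` with `K = s + 2` is a localized weight. With
`h i = f - T i`, the error is the weighted mean of the `h i`. The decay of the weights turns the
Taylor bounds `‖h i x‖ ≤ A * ‖x - i / N‖ ^ β` and `‖D (h i) x‖ ≤ A * ‖x - i / N‖ ^ (β - 1)` into
bounds of order `N ^ (-β)` and `N ^ (-(β - 1))` for the weighted means
(`exists_sum_gridWeight_mul_rpow_le`). Differentiating the weights costs only a factor of order `N`,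
since `‖D (W i)‖` is at most a constant times `N * W i`, and this gives the `C^1` bound
(`exists_hasFDerivWithinAt_weightedMean`, `exists_taylorMean_approx`).

The width is of order `N`, although the grid has `(N + 1) ^ d` points, because the weights are
products of univariate bumps: the first layer computes the `d * (N + 1)` univariate bumps and passes
on the coordinates, and the numerator and the denominator of `F` are polynomials in these numbers,
with degrees that do not depend on `N`. The denominator has to be positive on the whole space and
not only on the outputs of the first layer, so it is modified by squares that vanish on these
outputs (`eval_meanDen`, `eval_meanDen_pos`). Dividing by common factors puts the quotient in lowest
terms, and a zero numerator is replaced by a tiny constant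
(`RationalFunction.exists_eval_eq_div_add`). Identity layers bring the depth up to `⌊β⌋ + 2`. All
activations thus have degrees bounded independently of `N`.

The Taylor bounds on the closed cube are proved for the iterated derivatives within the cube, by
induction on the order: the derivative of the Taylor polynomial of `f` is the Taylor polynomial of
the derivative of `f` (`hasFDerivAt_taylorSum_succ`), which needs only the symmetry of second
derivatives.
-/

/-! ### Taylor polynomials on a convex set -/

section Taylor

variable {E F : Type} [NormedAddCommGroup E] [NormedSpace ℝ E]
  [NormedAddCommGroup F] [NormedSpace ℝ F]

/-- The homogeneous part of degree `k`, up to the factor `1 / k!`, of the Taylor polynomial of `f`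
at `x₀`; derivatives are taken within `s`. -/
noncomputable def taylorTerm (k : ℕ) (f : E → F) (s : Set E) (x₀ x : E) : F :=
  iteratedFDerivWithin ℝ k f s x₀ fun _ => x - x₀

/-- The Taylor polynomial of order `n` of `f` at `x₀`, with derivatives taken within `s`. -/
noncomputable def taylorSum (n : ℕ) (f : E → F) (s : Set E) (x₀ x : E) : F :=
  ∑ k ∈ Finset.range (n + 1), ((k.factorial : ℝ)⁻¹) • taylorTerm k f s x₀ x

theorem taylorTerm_succ (k : ℕ) (f : E → F) {s : Set E} (hs : UniqueDiffOn ℝ s) {x₀ : E}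
    (hx₀ : x₀ ∈ s) (x : E) :
    taylorTerm (k + 1) f s x₀ x = taylorTerm k (fderivWithin ℝ f s) s x₀ x (x - x₀) := by
  simp only [taylorTerm, iteratedFDerivWithin_succ_apply_right hs hx₀]
  rfl

/-- Symmetry of the second derivative passes to its iterated derivatives, since taking the flip
of a bilinear map is linear and continuous. -/
theorem taylorTerm_fderivWithin_fderivWithin_symm (k : ℕ) {f : E → F} {s : Set E}
    (hs : UniqueDiffOn ℝ s) (hc : s ⊆ closure (interior s)) (hf : ContDiffOn ℝ (k + 2 : ℕ) f s)
    {x₀ : E} (hx₀ : x₀ ∈ s) (x v w : E) :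
    taylorTerm k (fderivWithin ℝ (fderivWithin ℝ f s) s) s x₀ x v w =
      taylorTerm k (fderivWithin ℝ (fderivWithin ℝ f s) s) s x₀ x w v := by
  set D := fderivWithin ℝ (fderivWithin ℝ f s) s with hD
  have h1 : ContDiffOn ℝ (k + 1 : ℕ) (fderivWithin ℝ f s) s :=
    hf.fderivWithin hs (by norm_cast)
  have h2 : ContDiffOn ℝ k D s := h1.fderivWithin hs (by norm_cast)
  let L : (E →L[ℝ] E →L[ℝ] F) →L[ℝ] (E →L[ℝ] E →L[ℝ] F) :=
    (ContinuousLinearMap.flipₗᵢ ℝ E E F).toContinuousLinearEquiv.toContinuousLinearMap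
  have hflip : Set.EqOn (L ∘ D) D s := by
    intro y hy
    have hsymm : IsSymmSndFDerivWithinAt ℝ f s y :=
      (hf y hy).isSymmSndFDerivWithinAt (by
        simp only [minSmoothness_of_isRCLikeNormedField]
        exact_mod_cast (by omega : 2 ≤ k + 2)) hs (hc hy) hy
    ext v w
    exact hsymm w v
  have key : iteratedFDerivWithin ℝ k D s x₀ =
      L.compContinuousMultilinearMap
        (iteratedFDerivWithin ℝ k D s x₀) := by
    conv_lhs => rw [← iteratedFDerivWithin_congr hflip hx₀]
    exact ContinuousLinearMap.iteratedFDerivWithin_comp_left (F := E →L[ℝ] E →L[ℝ] F)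
      (G := E →L[ℝ] E →L[ℝ] F) L (h2 x₀ hx₀) hs hx₀ le_rfl
  unfold taylorTerm
  conv_lhs => rw [key]
  rfl

theorem hasFDerivAt_taylorTerm_succ (k : ℕ) {f : E → F} {s : Set E}
    (hs : UniqueDiffOn ℝ s) (hc : s ⊆ closure (interior s)) (hf : ContDiffOn ℝ (k + 1 : ℕ) f s)
    {x₀ : E} (hx₀ : x₀ ∈ s) (x : E) :
    HasFDerivAt (taylorTerm (k + 1) f s x₀)
      ((k + 1 : ℝ) • taylorTerm k (fderivWithin ℝ f s) s x₀ x) x := by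
  induction k generalizing F with
  | zero =>
    have h : taylorTerm 1 f s x₀ = fun y => fderivWithin ℝ f s x₀ (y - x₀) := by
      ext y
      rw [taylorTerm_succ 0 f hs hx₀]
      simp only [taylorTerm, iteratedFDerivWithin_zero_apply]
    have h' : taylorTerm 0 (fderivWithin ℝ f s) s x₀ x = fderivWithin ℝ f s x₀ := by
      simp [taylorTerm]
    rw [zero_add, h, h']
    have h0 := (fderivWithin ℝ f s x₀).hasFDerivAt.comp x ((hasFDerivAt_id x).sub_const x₀)
    rw [Nat.cast_zero, zero_add, one_smul]
    exact h0.congr_fderiv (ContinuousLinearMap.comp_id _)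
  | succ k ih =>
    have h1 : ContDiffOn ℝ (k + 1 : ℕ) (fderivWithin ℝ f s) s :=
      hf.fderivWithin hs (by norm_cast)
    have h : taylorTerm (k + 1 + 1) f s x₀ =
        fun y => taylorTerm (k + 1) (fderivWithin ℝ f s) s x₀ y (y - x₀) := by
      ext y
      rw [taylorTerm_succ _ f hs hx₀]
    rw [h]
    refine ((ih h1).clm_apply ((hasFDerivAt_id x).sub_const x₀)).congr_fderiv ?_
    ext v
    have hsymm := taylorTerm_fderivWithin_fderivWithin_symm k hs hc hf hx₀ x v (x - x₀)
    have h2 := congrArg (fun B => B v) (taylorTerm_succ k (fderivWithin ℝ f s) hs hx₀ x)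
    simp only [add_apply, ContinuousLinearMap.coe_comp, Function.comp_apply,
      ContinuousLinearMap.flip_apply, smul_apply, ContinuousLinearMap.id_apply, id_eq] at h2 ⊢
    rw [hsymm, ← h2]
    push_cast
    module

theorem hasFDerivAt_taylorSum_succ (n : ℕ) {f : E → F} {s : Set E}
    (hs : UniqueDiffOn ℝ s) (hc : s ⊆ closure (interior s)) (hf : ContDiffOn ℝ (n + 1 : ℕ) f s)
    {x₀ : E} (hx₀ : x₀ ∈ s) (x : E) :
    HasFDerivAt (taylorSum (n + 1) f s x₀) (taylorSum n (fderivWithin ℝ f s) s x₀ x) x := by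
  have h : taylorSum (n + 1) f s x₀ = fun y => ∑ k ∈ Finset.range (n + 1),
      (((k + 1).factorial : ℝ)⁻¹) • taylorTerm (k + 1) f s x₀ y + f x₀ := by
    ext y
    rw [taylorSum, Finset.sum_range_succ']
    simp [taylorTerm]
  rw [h]
  refine HasFDerivAt.add_const _ ?_
  refine (HasFDerivAt.fun_sum fun k hk => (hasFDerivAt_taylorTerm_succ k hs hc
    (hf.of_le ?_) hx₀ x).const_smul _).congr_fderiv ?_
  · have := Finset.mem_range.1 hk
    exact_mod_cast (by omega : k + 1 ≤ n + 1)
  · refine Finset.sum_congr rfl fun k _ => ?_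
    rw [smul_smul, Nat.factorial_succ]
    congr 1
    have := Nat.cast_add_one_ne_zero (R := ℝ) k
    push_cast
    field_simp

theorem norm_iteratedFDerivWithin_succ_sub (n : ℕ) (f : E → F) {s : Set E}
    (hs : UniqueDiffOn ℝ s) {x y : E} (hx : x ∈ s) (hy : y ∈ s) :
    ‖iteratedFDerivWithin ℝ (n + 1) f s x - iteratedFDerivWithin ℝ (n + 1) f s y‖ =
      ‖iteratedFDerivWithin ℝ n (fderivWithin ℝ f s) s x -
        iteratedFDerivWithin ℝ n (fderivWithin ℝ f s) s y‖ := by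
  rw [iteratedFDerivWithin_succ_eq_comp_right hs hx, iteratedFDerivWithin_succ_eq_comp_right hs hy,
    Function.comp_apply, Function.comp_apply, ← LinearIsometryEquiv.map_sub,
    LinearIsometryEquiv.norm_map]

theorem taylorSum_self (n : ℕ) (f : E → F) (s : Set E) (x₀ : E) : taylorSum n f s x₀ x₀ = f x₀ := by
  rw [taylorSum, Finset.sum_range_succ', Finset.sum_eq_zero]
  · simp [taylorTerm]
  · intro k _
    rw [taylorTerm, ContinuousMultilinearMap.map_coord_zero _ 0 (sub_self x₀), smul_zero]

/-- Taylor's theorem with a Hölder bound on the highest derivative. The bound is integrated once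
for each order by the mean value inequality on the segment from `x₀` to `x`, so no factorials
appear. -/
theorem norm_sub_taylorSum_le (n : ℕ) {f : E → F} {s : Set E} (hconv : Convex ℝ s)
    (hs : UniqueDiffOn ℝ s) (hc : s ⊆ closure (interior s)) (hf : ContDiffOn ℝ n f s)
    {x₀ : E} (hx₀ : x₀ ∈ s) {M δ : ℝ} (hδ : 0 ≤ δ) (hM : 0 ≤ M)
    (hbound : ∀ x ∈ s, ‖iteratedFDerivWithin ℝ n f s x - iteratedFDerivWithin ℝ n f s x₀‖ ≤
      M * ‖x - x₀‖ ^ δ) {x : E} (hx : x ∈ s) :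
    ‖f x - taylorSum n f s x₀ x‖ ≤ M * ‖x - x₀‖ ^ (n + δ) := by
  induction n generalizing F x with
  | zero =>
    have h := hbound x hx
    simp only [iteratedFDerivWithin_zero_eq_comp, Function.comp_apply, ← map_sub,
      LinearIsometryEquiv.norm_map] at h
    simpa [taylorSum, taylorTerm] using h
  | succ n ih =>
    have h1 : ContDiffOn ℝ n (fderivWithin ℝ f s) s := hf.fderivWithin hs (by norm_cast)
    have hdiff : ∀ y ∈ s, HasFDerivWithinAt (fun z => f z - taylorSum (n + 1) f s x₀ z)
        (fderivWithin ℝ f s y - taylorSum n (fderivWithin ℝ f s) s x₀ y) s y := fun y hy =>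
      ((hf.differentiableOn (by norm_cast) y hy).hasFDerivWithinAt).sub
        (hasFDerivAt_taylorSum_succ n hs hc hf hx₀ y).hasFDerivWithinAt
    have hb : ∀ y ∈ s, ‖fderivWithin ℝ f s y - taylorSum n (fderivWithin ℝ f s) s x₀ y‖ ≤
        M * ‖y - x₀‖ ^ (n + δ) := by
      intro y hy
      refine ih h1 (fun z hz => ?_) hy
      rw [← norm_iteratedFDerivWithin_succ_sub n f hs hz hx₀]
      exact hbound z hz
    have hseg : segment ℝ x₀ x ⊆ s := hconv.segment_subset hx₀ hx
    have hmv := (convex_segment x₀ x).norm_image_sub_le_of_norm_hasFDerivWithin_le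
      (C := M * ‖x - x₀‖ ^ (n + δ)) (fun y hy => (hdiff y (hseg hy)).mono hseg)
      (fun y hy => (hb y (hseg hy)).trans (by
        gcongr
        exact norm_sub_le_of_mem_segment hy)) (left_mem_segment ℝ x₀ x) (right_mem_segment ℝ x₀ x)
    rw [taylorSum_self, sub_self, sub_zero] at hmv
    refine hmv.trans_eq ?_
    have : ((n + 1 : ℕ) : ℝ) + δ = n + δ + 1 := by push_cast; ring
    rw [this, Real.rpow_add_one' (norm_nonneg _) (by positivity), mul_assoc]

end Taylor

/-! ### Hölder functions on the unit cube -/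

section Cube

theorem convex_unitCube (d : ℕ) : Convex ℝ (unitCube d) := convex_Icc 0 1

theorem nonempty_interior_unitCube (d : ℕ) : (interior (unitCube d)).Nonempty := by
  refine ⟨fun _ => 1 / 2, ?_⟩
  rw [unitCube, ← Set.pi_univ_Icc, interior_pi_set Set.finite_univ]
  intro j _
  simp only [Pi.zero_apply, Pi.one_apply, interior_Icc, Set.mem_Ioo]
  norm_num

theorem uniqueDiffOn_unitCube (d : ℕ) : UniqueDiffOn ℝ (unitCube d) :=
  uniqueDiffOn_convex (convex_unitCube d) (nonempty_interior_unitCube d)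

theorem unitCube_subset_closure_interior (d : ℕ) :
    unitCube d ⊆ closure (interior (unitCube d)) := by
  rw [(convex_unitCube d).closure_interior_eq_closure_of_nonempty_interior
    (nonempty_interior_unitCube d)]
  exact subset_closure

variable {d : ℕ} {F : Type} [NormedAddCommGroup F] [NormedSpace ℝ F]

theorem ContinuousMultilinearMap.apply_eq_sum_single {k : ℕ}
    (A : ContinuousMultilinearMap ℝ (fun _ : Fin k => Fin d → ℝ) F) (v : Fin k → Fin d → ℝ) :
    A v = ∑ r : Fin k → Fin d, (∏ a, v a (r a)) • A fun a => Pi.single (r a) 1 := by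
  have hv : v = fun a => ∑ j, v a j • (Pi.single j 1 : Fin d → ℝ) := by
    ext a j
    simp [Finset.sum_apply, Pi.single_apply]
  conv_lhs => rw [hv]
  rw [A.map_sum]
  exact Finset.sum_congr rfl fun r _ =>
    A.map_smul_univ (fun a => v a (r a)) fun a => Pi.single (r a) 1

theorem ContinuousMultilinearMap.opNorm_le_sum_single {k : ℕ}
    (A : ContinuousMultilinearMap ℝ (fun _ : Fin k => Fin d → ℝ) F) :
    ‖A‖ ≤ ∑ r : Fin k → Fin d, ‖A fun a => Pi.single (r a) 1‖ := by
  refine A.opNorm_le_bound (by positivity) fun v => ?_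
  rw [A.apply_eq_sum_single v, Finset.sum_mul]
  refine norm_sum_le_of_le _ fun r _ => ?_
  rw [norm_smul, mul_comm, norm_prod]
  gcongr with a
  exact norm_le_pi_norm (v a) (r a)

theorem exists_mvPolynomial_eval_eq_taylorSum {p : ℕ} (n : ℕ)
    (f : (Fin d → ℝ) → (Fin p → ℝ)) (s : Set (Fin d → ℝ)) (x₀ : Fin d → ℝ) (m : Fin p) :
    ∃ P : MvPolynomial (Fin d) ℝ, P.totalDegree ≤ n ∧
      ∀ x, MvPolynomial.eval x P = taylorSum n f s x₀ x m := by
  refine ⟨∑ k ∈ Finset.range (n + 1), ∑ r : Fin k → Fin d,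
    MvPolynomial.C ((k.factorial : ℝ)⁻¹ *
      iteratedFDerivWithin ℝ k f s x₀ (fun a => Pi.single (r a) 1) m) *
      ∏ a, (MvPolynomial.X (r a) - MvPolynomial.C (x₀ (r a))), ?_, fun x => ?_⟩
  · refine MvPolynomial.totalDegree_finsetSum_le fun k hk =>
      MvPolynomial.totalDegree_finsetSum_le fun r _ => ?_
    refine (MvPolynomial.totalDegree_mul _ _).trans ?_
    rw [MvPolynomial.totalDegree_C, zero_add]
    refine (MvPolynomial.totalDegree_finsetProd _ _).trans ?_
    have h1 : ∀ a ∈ (Finset.univ : Finset (Fin k)),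
        (MvPolynomial.X (r a) - MvPolynomial.C (x₀ (r a)) :
          MvPolynomial (Fin d) ℝ).totalDegree ≤ 1 := by
      intro a _
      refine (MvPolynomial.totalDegree_sub_C_le _ _).trans ?_
      simp
    refine (Finset.sum_le_card_nsmul _ _ 1 h1).trans ?_
    have := Finset.mem_range.1 hk
    simp only [Finset.card_univ, Fintype.card_fin, smul_eq_mul, mul_one]
    omega
  · simp only [map_sum, map_mul, map_prod, map_sub, MvPolynomial.eval_C, MvPolynomial.eval_X,
      taylorSum, Finset.sum_apply, Pi.smul_apply, taylorTerm, smul_eq_mul]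
    refine Finset.sum_congr rfl fun k _ => ?_
    rw [ContinuousMultilinearMap.apply_eq_sum_single, Finset.sum_apply, Finset.mul_sum]
    refine Finset.sum_congr rfl fun r _ => ?_
    simp only [Pi.smul_apply, Pi.sub_apply, smul_eq_mul]
    ring

theorem exists_norm_iteratedFDerivWithin_sub_le {p : ℕ} {β H : ℝ} (hβ : 0 ≤ β) (hH : 0 ≤ H)
    {f : (Fin d → ℝ) → (Fin p → ℝ)} (hf : f ∈ holderBall d p β H) :
    ∃ M : ℝ, 0 ≤ M ∧ ∀ x ∈ unitCube d, ∀ y ∈ unitCube d,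
      ‖iteratedFDerivWithin ℝ ⌊β⌋₊ f (unitCube d) x -
        iteratedFDerivWithin ℝ ⌊β⌋₊ f (unitCube d) y‖ ≤ M * ‖x - y‖ ^ (β - ⌊β⌋₊) := by
  set s := ⌊β⌋₊
  have hδ : 0 ≤ β - s := sub_nonneg.2 (Nat.floor_le hβ)
  let L : (Fin d → ℝ) →L[ℝ] EuclideanSpace ℝ (Fin d) :=
    (EuclideanSpace.equiv (Fin d) ℝ).symm.toContinuousLinearMap
  refine ⟨∑ _r : Fin s → Fin d, H * ‖L‖ ^ (β - s), by positivity, fun x hx y hy => ?_⟩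
  refine (ContinuousMultilinearMap.opNorm_le_sum_single _).trans ?_
  rw [Finset.sum_mul]
  refine Finset.sum_le_sum fun r _ => ?_
  refine (pi_norm_le_iff_of_nonneg (by positivity)).2 fun m => ?_
  by_cases hxy : x = y
  · subst hxy
    simp only [sub_self, zero_apply, Pi.zero_apply, norm_zero]
    positivity
  have h1 : ENNReal.ofReal (|partialDeriv r f x m - partialDeriv r f y m| /
      (min 1 ‖WithLp.toLp 2 (x - y)‖) ^ (β - s)) ≤ ENNReal.ofReal H := by
    refine le_trans ?_ hf.2
    refine le_trans ?_ (le_max_right _ _)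
    refine le_trans ?_ (le_iSup _ r)
    refine le_trans ?_ (le_iSup _ m)
    refine le_trans ?_ (le_iSup₂ x hx)
    refine le_trans ?_ (le_iSup₂ y hy)
    exact le_iSup (fun _ : x ≠ y => _) hxy
  rw [ENNReal.ofReal_le_ofReal_iff hH] at h1
  have hne : (WithLp.toLp 2 (x - y) : EuclideanSpace ℝ (Fin d)) ≠ 0 := by
    intro h
    exact hxy (sub_eq_zero.1 (congrArg WithLp.ofLp h))
  have hpos : 0 < min 1 ‖(WithLp.toLp 2 (x - y) : EuclideanSpace ℝ (Fin d))‖ :=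
    lt_min one_pos (norm_pos_iff.2 hne)
  rw [div_le_iff₀ (Real.rpow_pos_of_pos hpos _)] at h1
  refine h1.trans ?_
  rw [mul_assoc, ← Real.mul_rpow (norm_nonneg _) (norm_nonneg _)]
  gcongr
  exact (min_le_right _ _).trans (L.le_opNorm (x - y))

end Cube

/-! ### Localized weights on a grid -/

section Weights

/-- The rational bump `(1 + t ^ 2) ^ (-M)` around the origin. Its derivative is at most a
multiple of the bump itself. -/
noncomputable def bump (M : ℕ) (t : ℝ) : ℝ := ((1 + t ^ 2) ^ M)⁻¹

theorem bump_pos (M : ℕ) (t : ℝ) : 0 < bump M t := by unfold bump; positivity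

theorem exists_hasDerivAt_bump (M : ℕ) (t : ℝ) :
    ∃ b : ℝ, HasDerivAt (bump M) b t ∧ |b| ≤ M * bump M t := by
  have h0 : 0 < 1 + t ^ 2 := by positivity
  have h1 : HasDerivAt (fun y : ℝ => 1 + y ^ 2) (2 * t) t := by
    simpa using ((hasDerivAt_id t).pow 2).const_add 1
  have h2 := (h1.pow M).inv (pow_pos h0 M).ne'
  refine ⟨_, h2, ?_⟩
  rcases M with _ | M
  · simp
  · have hb : |2 * t| ≤ 1 + t ^ 2 := by
      rw [abs_le]; constructor <;> nlinarith [sq_nonneg (t + 1), sq_nonneg (t - 1)]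
    simp only [bump, Pi.pow_apply]
    rw [abs_div, abs_neg, abs_mul, abs_mul,
      abs_of_nonneg (by positivity : (0 : ℝ) ≤ ((M + 1 : ℕ) : ℝ)), abs_of_pos (pow_pos h0 _),
      abs_of_pos (pow_pos (pow_pos h0 _) 2), Nat.add_sub_cancel,
      div_le_iff₀ (by positivity)]
    have e : (((M + 1 : ℕ) : ℝ) * ((1 + t ^ 2) ^ (M + 1))⁻¹) * ((1 + t ^ 2) ^ (M + 1)) ^ 2 =
        ((M + 1 : ℕ) : ℝ) * (1 + t ^ 2) ^ M * (1 + t ^ 2) := by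
      field_simp
      ring
    rw [e]
    gcongr

/-- The tensor product bump around the grid point `i / N`, at scale `1 / N`. -/
noncomputable def gridWeight {d : ℕ} (M N : ℕ) (i : Fin d → Fin (N + 1)) (x : Fin d → ℝ) : ℝ :=
  ∏ j, bump M (N * x j - (i j : ℕ))

/-- The point `i / N` of the regular grid of mesh `1 / N` in the unit cube. -/
noncomputable def gridPoint {d : ℕ} (N : ℕ) (i : Fin d → Fin (N + 1)) : Fin d → ℝ :=
  fun j => ((i j : ℕ) : ℝ) / N

variable {d : ℕ}

theorem gridWeight_pos (M N : ℕ) (i : Fin d → Fin (N + 1)) (x : Fin d → ℝ) :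
    0 < gridWeight M N i x :=
  Finset.prod_pos fun _ _ => bump_pos _ _

theorem gridPoint_mem (N : ℕ) (i : Fin d → Fin (N + 1)) : gridPoint N i ∈ unitCube d := by
  constructor
  · intro j
    simp only [gridPoint, Pi.zero_apply]
    positivity
  · intro j
    refine div_le_one_of_le₀ ?_ (by positivity)
    exact Nat.cast_le.2 (Nat.lt_succ_iff.1 (i j).2)

theorem sum_gridWeight (M N : ℕ) (x : Fin d → ℝ) :
    ∑ i : Fin d → Fin (N + 1), gridWeight M N i x =
      ∏ j, ∑ l : Fin (N + 1), bump M (N * x j - (l : ℕ)) := by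
  rw [Finset.prod_univ_sum, Fintype.piFinset_univ]
  rfl

theorem exists_hasFDerivAt_gridWeight (M N : ℕ) (i : Fin d → Fin (N + 1)) (x : Fin d → ℝ) :
    ∃ W' : (Fin d → ℝ) →L[ℝ] ℝ, HasFDerivAt (gridWeight M N i) W' x ∧
      ‖W'‖ ≤ (d * M * N : ℝ) * gridWeight M N i x := by
  choose b hb hb' using exists_hasDerivAt_bump M
  have h1 : ∀ j ∈ (Finset.univ : Finset (Fin d)),
      HasFDerivAt (fun y : Fin d → ℝ => bump M (N * y j - (i j : ℕ)))
        (b (N * x j - (i j : ℕ)) • (N : ℝ) • ContinuousLinearMap.proj (R := ℝ) (φ := fun _ => ℝ) j)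
        x := by
    intro j _
    have h2 : HasFDerivAt (fun y : Fin d → ℝ => (N : ℝ) * y j - (i j : ℕ))
        ((N : ℝ) • ContinuousLinearMap.proj (R := ℝ) (φ := fun _ => ℝ) j) x :=
      ((hasFDerivAt_apply j x).const_mul (N : ℝ)).sub_const _
    exact (hb _).comp_hasFDerivAt x h2
  refine ⟨_, HasFDerivAt.finsetProd h1, ?_⟩
  have h3 : ∀ j ∈ (Finset.univ : Finset (Fin d)),
      ‖(∏ k ∈ Finset.univ.erase j, bump M (N * x k - (i k : ℕ))) •
        b (N * x j - (i j : ℕ)) • (N : ℝ) •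
          ContinuousLinearMap.proj (R := ℝ) (φ := fun _ : Fin d => ℝ) j‖ ≤
        (M * N : ℝ) * gridWeight M N i x := by
    intro j hj
    have hproj : ‖(ContinuousLinearMap.proj (R := ℝ) (φ := fun _ : Fin d => ℝ) j)‖ ≤ 1 :=
      ContinuousLinearMap.opNorm_le_bound _ zero_le_one fun v => by
        simpa using norm_le_pi_norm v j
    rw [norm_smul, norm_smul, norm_smul, gridWeight, ← Finset.prod_erase_mul _ _ hj,
      Real.norm_of_nonneg (Finset.prod_nonneg fun k _ => (bump_pos _ _).le), Real.norm_eq_abs,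
      Real.norm_of_nonneg (Nat.cast_nonneg N)]
    calc _ ≤ (∏ k ∈ Finset.univ.erase j, bump M (N * x k - (i k : ℕ))) *
          ((M * bump M (N * x j - (i j : ℕ))) * (N * 1)) := by
          have := Finset.prod_nonneg (s := Finset.univ.erase j)
            (f := fun k => bump M (N * x k - (i k : ℕ))) fun k _ => (bump_pos _ _).le
          have h4 := hb' (N * x j - (i j : ℕ))
          have h5 := (bump_pos M (N * x j - (i j : ℕ))).le
          gcongr
      _ = _ := by ring
  refine (norm_sum_le_of_le _ h3).trans_eq ?_
  simp only [Finset.sum_const, Finset.card_univ, Fintype.card_fin, nsmul_eq_mul]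
  ring

theorem exists_sum_bump_one_le :
    ∃ B : ℝ, 0 < B ∧ ∀ (n : ℕ) (y : ℝ), ∑ l : Fin n, bump 1 (y - (l : ℕ)) ≤ B := by
  have hs : Summable fun k : ℤ => (1 + (k : ℝ) ^ 2)⁻¹ := by
    have h := Real.summable_one_div_int_pow.2 (one_lt_two)
    refine Summable.of_norm_bounded_eventually h ?_
    have : {k : ℤ | k = 0}.Finite := Set.finite_singleton 0
    filter_upwards [this.compl_mem_cofinite] with k hk
    have hk' : (0 : ℝ) < (k : ℝ) ^ 2 := by
      have : (k : ℝ) ≠ 0 := by exact_mod_cast hk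
      positivity
    rw [Real.norm_of_nonneg (by positivity), one_div]
    exact inv_anti₀ hk' (by linarith)
  refine ⟨3 * ∑' k : ℤ, (1 + (k : ℝ) ^ 2)⁻¹, ?_, fun n y => ?_⟩
  · have := hs.tsum_pos (fun k => by positivity) 0 (by norm_num)
    positivity
  have h1 : ∀ l : Fin n, bump 1 (y - (l : ℕ)) ≤
      3 * (1 + ((⌊y⌋ - ((l : ℕ) : ℤ) : ℤ) : ℝ) ^ 2)⁻¹ := by
    intro l
    have hy1 := Int.floor_le y
    have hy2 := Int.lt_floor_add_one y
    rw [bump, pow_one, ← div_eq_mul_inv, inv_eq_one_div,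
      div_le_div_iff₀ (by positivity) (by positivity)]
    push_cast
    -- moving `y` by less than one changes `1 + t ^ 2` by a factor of at most three
    nlinarith [sq_nonneg ((y - (l : ℕ)) + (y - ⌊y⌋)),
      mul_nonneg (sub_nonneg.2 hy1) (sub_nonneg.2 hy2.le)]
  refine (Finset.sum_le_sum fun l _ => h1 l).trans ?_
  rw [← Finset.mul_sum]
  gcongr
  have hinj : Function.Injective fun l : Fin n => (⌊y⌋ - ((l : ℕ) : ℤ) : ℤ) := by
    intro a b hab
    ext
    simpa using hab
  refine (Finset.sum_map Finset.univ ⟨_, hinj⟩ fun k : ℤ => (1 + (k : ℝ) ^ 2)⁻¹).symm.trans_le ?_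
  exact hs.sum_le_tsum _ fun k _ => by positivity

theorem le_sum_gridWeight (M : ℕ) {N : ℕ} {x : Fin d → ℝ} (hx : x ∈ unitCube d) :
    ((2 : ℝ) ^ M)⁻¹ ^ d ≤ ∑ i : Fin d → Fin (N + 1), gridWeight M N i x := by
  rw [sum_gridWeight]
  have h : ∀ j ∈ (Finset.univ : Finset (Fin d)),
      ((2 : ℝ) ^ M)⁻¹ ≤ ∑ l : Fin (N + 1), bump M (N * x j - (l : ℕ)) := by
    intro j _
    have h0 : 0 ≤ N * x j := mul_nonneg (Nat.cast_nonneg N) (hx.1 j)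
    have h1 : N * x j ≤ N := mul_le_of_le_one_right (Nat.cast_nonneg N) (hx.2 j)
    have hl : ⌊N * x j⌋₊ < N + 1 :=
      Nat.lt_succ_of_le ((Nat.floor_le_floor h1).trans_eq (Nat.floor_natCast N))
    refine le_trans ?_ (Finset.single_le_sum (f := fun l : Fin (N + 1) =>
      bump M (N * x j - (l : ℕ))) (fun l _ => (bump_pos _ _).le) (Finset.mem_univ ⟨_, hl⟩))
    have h2 := Nat.floor_le h0
    have h3 := Nat.lt_floor_add_one (N * x j)
    unfold bump
    refine inv_anti₀ (by positivity) (pow_le_pow_left₀ (by positivity) ?_ M)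
    simp only
    nlinarith
  simpa using Finset.prod_le_prod (fun _ _ => by positivity) h

/-- The distance to a grid point is absorbed by the decay of the weight. -/
theorem gridWeight_mul_rpow_le {m M N : ℕ} (hM : m + 1 ≤ M) {γ : ℝ} (hγ : 0 ≤ γ) (hγm : γ ≤ m)
    (i : Fin d → Fin (N + 1)) (x : Fin d → ℝ) :
    gridWeight M N i x * ‖fun j => N * x j - (i j : ℕ)‖ ^ γ ≤ gridWeight 1 N i x := by
  set t : Fin d → ℝ := fun j => N * x j - (i j : ℕ) with ht
  have h1 : ‖t‖ ^ γ ≤ ∏ j, (1 + t j ^ 2) ^ m := by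
    have hone : ∀ j, 1 ≤ (1 + t j ^ 2) ^ m := fun j =>
      one_le_pow₀ (by linarith [sq_nonneg (t j)])
    have hprod : 1 ≤ ∏ j, (1 + t j ^ 2) ^ m := Finset.one_le_prod fun j _ => hone j
    rcases le_total ‖t‖ 1 with h | h
    · exact (Real.rpow_le_one (norm_nonneg _) h hγ).trans hprod
    · have hne : Nonempty (Fin d) := by
        by_contra hne
        rw [not_nonempty_iff] at hne
        have : t = 0 := Subsingleton.elim _ _
        rw [this, norm_zero] at h
        linarith
      obtain ⟨j, hj⟩ := Finite.exists_max fun j => ‖t j‖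
      have htj : ‖t‖ ≤ |t j| := (pi_norm_le_iff_of_nonneg (norm_nonneg _)).2 hj
      calc ‖t‖ ^ γ ≤ ‖t‖ ^ (m : ℝ) := Real.rpow_le_rpow_of_exponent_le h hγm
        _ = ‖t‖ ^ m := Real.rpow_natCast _ _
        _ ≤ (1 + t j ^ 2) ^ m := by
          gcongr
          rw [← sq_abs]
          nlinarith [sq_nonneg (|t j| - 1)]
        _ ≤ ∏ j, (1 + t j ^ 2) ^ m := by
          rw [← Finset.prod_erase_mul _ _ (Finset.mem_univ j)]
          exact le_mul_of_one_le_left (by positivity) (Finset.one_le_prod fun k _ => hone k)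
  refine (mul_le_mul_of_nonneg_left h1 (gridWeight_pos M N i x).le).trans ?_
  rw [gridWeight, gridWeight, ← Finset.prod_mul_distrib]
  refine Finset.prod_le_prod (fun j _ => mul_nonneg (bump_pos _ _).le (by positivity)) fun j _ => ?_
  have h0 : 1 ≤ 1 + t j ^ 2 := by linarith [sq_nonneg (t j)]
  change ((1 + t j ^ 2) ^ M)⁻¹ * (1 + t j ^ 2) ^ m ≤ ((1 + t j ^ 2) ^ 1)⁻¹
  rw [inv_mul_le_iff₀ (by positivity), ← div_eq_mul_inv, le_div_iff₀ (by positivity), ← pow_add]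
  exact pow_le_pow_right₀ h0 hM

/-- The weighted mean of `‖x - i / N‖ ^ γ` over the grid is of order `N ^ (-γ)`: the numerator
factors into one-dimensional sums that are bounded uniformly in `N`, and the denominator is bounded
below by the weight of a grid point next to `x`. -/
theorem exists_sum_gridWeight_mul_rpow_le (d : ℕ) {m M : ℕ} (hM : m + 1 ≤ M) :
    ∃ B : ℝ, 0 < B ∧ ∀ γ : ℝ, 0 ≤ γ → γ ≤ m → ∀ N : ℕ, 1 ≤ N → ∀ x ∈ unitCube d,
      ∑ i : Fin d → Fin (N + 1), gridWeight M N i x * ‖x - gridPoint N i‖ ^ γ ≤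
        B * (N : ℝ) ^ (-γ) * ∑ i : Fin d → Fin (N + 1), gridWeight M N i x := by
  obtain ⟨B, hB, hsum⟩ := exists_sum_bump_one_le
  refine ⟨B ^ d * (((2 : ℝ) ^ M)⁻¹ ^ d)⁻¹, by positivity, fun γ hγ hγm N hN x hx => ?_⟩
  have hN0 : (0 : ℝ) < N := by exact_mod_cast hN
  have h1 : ∀ i : Fin d → Fin (N + 1), gridWeight M N i x * ‖x - gridPoint N i‖ ^ γ ≤
      (N : ℝ) ^ (-γ) * gridWeight 1 N i x := by
    intro i
    have e : x - gridPoint N i = (N : ℝ)⁻¹ • fun j => N * x j - (i j : ℕ) := by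
      ext j
      simp only [Pi.sub_apply, gridPoint, Pi.smul_apply, smul_eq_mul]
      field_simp
    rw [e, norm_smul, Real.norm_of_nonneg (by positivity),
      Real.mul_rpow (by positivity) (norm_nonneg _), Real.inv_rpow hN0.le, ← Real.rpow_neg hN0.le,
      mul_left_comm]
    gcongr
    exact gridWeight_mul_rpow_le hM hγ hγm i x
  refine (Finset.sum_le_sum fun i _ => h1 i).trans ?_
  rw [← Finset.mul_sum, sum_gridWeight]
  have h2 : ∏ j, ∑ l : Fin (N + 1), bump 1 (N * x j - (l : ℕ)) ≤ B ^ d := by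
    refine (Finset.prod_le_prod (fun j _ => Finset.sum_nonneg fun l _ => (bump_pos _ _).le)
      fun j _ => hsum (N + 1) (N * x j)).trans_eq ?_
    simp
  calc _ ≤ (N : ℝ) ^ (-γ) * B ^ d := by gcongr
    _ = B ^ d * (((2 : ℝ) ^ M)⁻¹ ^ d)⁻¹ * (N : ℝ) ^ (-γ) * ((2 : ℝ) ^ M)⁻¹ ^ d := by
      have : ((2 : ℝ) ^ M)⁻¹ ^ d ≠ 0 := by positivity
      field_simp
    _ ≤ _ := by
      gcongr
      exact le_sum_gridWeight M hx

end Weights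

/-! ### Weighted means of Taylor polynomials -/

section WeightedMean

/-- If the derivative of each weight is at most `L` times the weight, then the derivative of a
weighted mean is controlled by the weighted means of the norms of the functions and of their
derivatives. -/
theorem exists_hasFDerivWithinAt_weightedMean {ι E F : Type} [Fintype ι]
    [NormedAddCommGroup E] [NormedSpace ℝ E] [NormedAddCommGroup F] [NormedSpace ℝ F]
    {W : ι → E → ℝ} {W' : ι → E →L[ℝ] ℝ} {h : ι → E → F} {h' : ι → E →L[ℝ] F} {s : Set E} {x : E}
    {L A B : ℝ} (hL : 0 ≤ L) (hW : ∀ i, HasFDerivWithinAt (W i) (W' i) s x)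
    (hh : ∀ i, HasFDerivWithinAt (h i) (h' i) s x) (hpos : ∀ i, 0 ≤ W i x)
    (hW' : ∀ i, ‖W' i‖ ≤ L * W i x) (hS : 0 < ∑ i, W i x)
    (hA : ∑ i, W i x * ‖h i x‖ ≤ A * ∑ i, W i x) (hB : ∑ i, W i x * ‖h' i‖ ≤ B * ∑ i, W i x) :
    ∃ D : E →L[ℝ] F, HasFDerivWithinAt (fun y => (∑ i, W i y)⁻¹ • ∑ i, W i y • h i y) D s x ∧
      ‖D‖ ≤ 2 * L * A + B := by
  have h1 : HasFDerivWithinAt (fun y => ∑ i, W i y) (∑ i, W' i) s x :=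
    HasFDerivWithinAt.fun_sum fun i _ => hW i
  have h2 : HasFDerivWithinAt (fun y => ∑ i, W i y • h i y)
      (∑ i, (W i x • h' i + (W' i).smulRight (h i x))) s x :=
    HasFDerivWithinAt.fun_sum fun i _ => (hW i).smul (hh i)
  have h3 : HasFDerivWithinAt (fun y => (∑ i, W i y)⁻¹) (-((∑ i, W i x) ^ 2)⁻¹ • ∑ i, W' i) s x :=
    (hasDerivAt_inv hS.ne').comp_hasFDerivWithinAt x h1
  refine ⟨_, h3.smul h2, ?_⟩
  set S := ∑ i, W i x
  have e1 : ‖∑ i, W i x • h i x‖ ≤ A * S :=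
    (norm_sum_le_of_le _ fun i _ => by
      rw [norm_smul, Real.norm_of_nonneg (hpos i)]).trans hA
  have e2 : ‖∑ i, W' i‖ ≤ L * S := by
    refine (norm_sum_le_of_le _ fun i _ => hW' i).trans_eq ?_
    rw [← Finset.mul_sum]
  have e3 : ‖∑ i, (W i x • h' i + (W' i).smulRight (h i x))‖ ≤ B * S + L * (A * S) := by
    refine (norm_sum_le_of_le (n := fun i => W i x * ‖h' i‖ + L * (W i x * ‖h i x‖)) _
      fun i _ => ?_).trans ?_
    · refine (norm_add_le _ _).trans ?_
      rw [norm_smul, Real.norm_of_nonneg (hpos i), ContinuousLinearMap.norm_smulRight_apply,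
        ← mul_assoc]
      gcongr
      exact hW' i
    · rw [Finset.sum_add_distrib, ← Finset.mul_sum]
      gcongr
  refine (norm_add_le _ _).trans ?_
  rw [norm_smul, ContinuousLinearMap.norm_smulRight_apply, norm_smul, norm_neg,
    Real.norm_of_nonneg (by positivity), Real.norm_of_nonneg (by positivity)]
  have e4 : 0 ≤ A * S := (norm_nonneg _).trans e1
  calc _ ≤ S⁻¹ * (B * S + L * (A * S)) + (S ^ 2)⁻¹ * (L * S) * (A * S) := by gcongr
    _ = 2 * L * A + B := by field_simp; ring

/-- A Hölder function is approximated in `C^1` by the weighted means of its Taylor polynomials at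
the grid points. -/
theorem exists_taylorMean_approx {d p : ℕ} {β H : ℝ} (hβ : 2 < β) (hH : 0 ≤ H)
    {f : (Fin d → ℝ) → (Fin p → ℝ)} (hf : f ∈ holderBall d p β H) {M : ℕ} (hM : ⌊β⌋₊ + 2 ≤ M) :
    ∃ c : ℝ, 0 < c ∧ ∀ N : ℕ, 1 ≤ N →
      ∃ P : (Fin d → Fin (N + 1)) → Fin p → MvPolynomial (Fin d) ℝ,
        (∀ i m, (P i m).totalDegree ≤ ⌊β⌋₊) ∧ ∃ g : (Fin d → ℝ) → (Fin p → ℝ),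
        (∀ x ∈ unitCube d, ∀ m, g x m = f x m -
          (∑ i, gridWeight M N i x * MvPolynomial.eval x (P i m)) / ∑ i, gridWeight M N i x) ∧
        ∀ x ∈ unitCube d, ‖g x‖ ≤ c * (N : ℝ) ^ (-(β - 1)) ∧
          ∃ D : (Fin d → ℝ) →L[ℝ] (Fin p → ℝ), HasFDerivWithinAt g D (unitCube d) x ∧
            ‖D‖ ≤ c * (N : ℝ) ^ (-(β - 1)) := by
  obtain ⟨A, hA, hAbound⟩ := exists_norm_iteratedFDerivWithin_sub_le (by linarith) hH hf
  obtain ⟨B, hB, hBbound⟩ := exists_sum_gridWeight_mul_rpow_le d (m := ⌊β⌋₊ + 1) hM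
  have hfs := hf.1
  have hfl := Nat.floor_le (by linarith : 0 ≤ β)
  have hfu := Nat.lt_floor_add_one β
  have hs2 : 2 ≤ ⌊β⌋₊ := Nat.le_floor (by exact_mod_cast hβ.le)
  generalize hs : ⌊β⌋₊ = s at *
  obtain ⟨n, rfl⟩ : ∃ n, s = n + 1 := ⟨s - 1, by omega⟩
  push_cast at hfl hfu
  have hδ : 0 ≤ β - ((n + 1 : ℕ) : ℝ) := by push_cast; linarith
  have hU := uniqueDiffOn_unitCube d
  have hI := unitCube_subset_closure_interior d
  have hconv := convex_unitCube d
  -- Taylor estimates for the function and for its derivative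
  have hT0 : ∀ x₀ ∈ unitCube d, ∀ x ∈ unitCube d,
      ‖f x - taylorSum (n + 1) f (unitCube d) x₀ x‖ ≤ A * ‖x - x₀‖ ^ β := by
    intro x₀ hx₀ x hx
    have h := norm_sub_taylorSum_le (n + 1) hconv hU hI hfs hx₀ hδ hA
      (fun y hy => hAbound y hy x₀ hx₀) hx
    rwa [add_sub_cancel] at h
  have hT1 : ∀ x₀ ∈ unitCube d, ∀ x ∈ unitCube d,
      ‖fderivWithin ℝ f (unitCube d) x -
        taylorSum n (fderivWithin ℝ f (unitCube d)) (unitCube d) x₀ x‖ ≤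
        A * ‖x - x₀‖ ^ (β - 1) := by
    intro x₀ hx₀ x hx
    have h := norm_sub_taylorSum_le n hconv hU hI (hfs.fderivWithin hU (by norm_cast)) hx₀ hδ hA
      (fun y hy => by
        rw [← norm_iteratedFDerivWithin_succ_sub n f hU hy hx₀]
        exact hAbound y hy x₀ hx₀) hx
    have e : (n : ℝ) + (β - ((n + 1 : ℕ) : ℝ)) = β - 1 := by push_cast; ring
    rwa [e] at h
  refine ⟨2 * (d * M) * (A * B) + A * B + 1, by positivity, fun N hN => ?_⟩
  have hN0 : (0 : ℝ) < N := by exact_mod_cast hN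
  have hpow : (N : ℝ) * (N : ℝ) ^ (-β) = (N : ℝ) ^ (-(β - 1)) := by
    rw [← Real.rpow_one_add' hN0.le (by linarith)]
    congr 1
    ring
  have hpow' : (N : ℝ) ^ (-β) ≤ (N : ℝ) ^ (-(β - 1)) :=
    Real.rpow_le_rpow_of_exponent_le (by exact_mod_cast hN) (by linarith)
  choose P hPdeg hP using fun (i : Fin d → Fin (N + 1)) (m : Fin p) =>
    exists_mvPolynomial_eval_eq_taylorSum (n + 1) f (unitCube d) (gridPoint N i) m
  refine ⟨P, hPdeg, fun x => (∑ i, gridWeight M N i x)⁻¹ • ∑ i : Fin d → Fin (N + 1),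
    gridWeight M N i x • (f x - taylorSum (n + 1) f (unitCube d) (gridPoint N i) x), ?_, ?_⟩
  · intro x hx m
    have hS : 0 < ∑ i : Fin d → Fin (N + 1), gridWeight M N i x :=
      lt_of_lt_of_le (by positivity) (le_sum_gridWeight M hx)
    simp only [hP, Pi.smul_apply, Finset.sum_apply, smul_eq_mul, Pi.sub_apply, mul_sub,
      Finset.sum_sub_distrib, ← Finset.sum_mul]
    field_simp
  intro x hx
  have hS : 0 < ∑ i : Fin d → Fin (N + 1), gridWeight M N i x :=
    lt_of_lt_of_le (by positivity) (le_sum_gridWeight M hx)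
  have hsum : ∀ {γ : ℝ} {u : (Fin d → Fin (N + 1)) → ℝ}, 0 ≤ γ → γ ≤ β →
      (∀ i, u i ≤ A * ‖x - gridPoint N i‖ ^ γ) →
      ∑ i, gridWeight M N i x * u i ≤
        A * B * (N : ℝ) ^ (-γ) * ∑ i : Fin d → Fin (N + 1), gridWeight M N i x := by
    intro γ u hγ hγβ hu
    have h := hBbound γ hγ (by push_cast; linarith) N hN x hx
    calc _ ≤ ∑ i, A * (gridWeight M N i x * ‖x - gridPoint N i‖ ^ γ) := by
          refine Finset.sum_le_sum fun i _ => ?_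
          rw [mul_left_comm]
          exact mul_le_mul_of_nonneg_left (hu i) (gridWeight_pos M N i x).le
      _ = A * ∑ i, gridWeight M N i x * ‖x - gridPoint N i‖ ^ γ := (Finset.mul_sum ..).symm
      _ ≤ A * (B * (N : ℝ) ^ (-γ) * ∑ i : Fin d → Fin (N + 1), gridWeight M N i x) := by gcongr
      _ = _ := by ring
  have hsum0 := hsum (by linarith) le_rfl fun i => hT0 _ (gridPoint_mem N i) x hx
  have hsum1 := hsum (by linarith) (by linarith) fun i => hT1 _ (gridPoint_mem N i) x hx
  constructor
  · rw [norm_smul, Real.norm_of_nonneg (inv_nonneg.2 hS.le), inv_mul_le_iff₀ hS]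
    refine (norm_sum_le_of_le _ fun i _ => by
      rw [norm_smul, Real.norm_of_nonneg (gridWeight_pos M N i x).le]).trans (hsum0.trans ?_)
    rw [mul_comm]
    gcongr
    have : 0 ≤ 2 * (d * M) * (A * B) := by positivity
    linarith
  · choose W' hW' hW'le using fun i : Fin d → Fin (N + 1) => exists_hasFDerivAt_gridWeight M N i x
    obtain ⟨D, hD, hDle⟩ := exists_hasFDerivWithinAt_weightedMean (s := unitCube d)
      (h := fun i y => f y - taylorSum (n + 1) f (unitCube d) (gridPoint N i) y)
      (by positivity) (fun i => (hW' i).hasFDerivWithinAt)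
      (fun i => ((hfs.differentiableOn (by norm_cast) x hx).hasFDerivWithinAt).sub
        (hasFDerivAt_taylorSum_succ n hU hI hfs (gridPoint_mem N i) x).hasFDerivWithinAt)
      (fun i => (gridWeight_pos M N i x).le) hW'le hS hsum0 hsum1
    refine ⟨D, hD, hDle.trans ?_⟩
    calc _ = (2 * (d * M) * (A * B) + A * B) * (N : ℝ) ^ (-(β - 1)) := by
          rw [← hpow]; ring
      _ ≤ _ := mul_le_mul_of_nonneg_right (by linarith) (by positivity)

end WeightedMean

/-! ### Rational functions and networks -/

section Networks

open MvPolynomial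

/-- Every quotient of polynomials with positive denominator is, up to an arbitrarily small constant
`e`, a rational function in lowest terms. The constant is needed only for the zero numerator, which
is not allowed in a `RationalFunction`. -/
theorem RationalFunction.exists_eval_eq_div_add {n : ℕ} (P Q : MvPolynomial (Fin n) ℝ)
    (hQ : ∀ z, 0 < MvPolynomial.eval z Q) {η : ℝ} (hη : 0 < η) :
    ∃ (r : RationalFunction n) (e : ℝ), |e| ≤ η ∧
      r.degree ≤ max P.totalDegree Q.totalDegree ∧
      ∀ z, r.eval z = MvPolynomial.eval z P / MvPolynomial.eval z Q + e := by
  by_cases hP : P = 0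
  · subst hP
    refine ⟨⟨C η, 1, by simpa using hη.ne', by simp, isRelPrime_one_right⟩, η,
      (abs_of_pos hη).le, ?_, fun z => ?_⟩
    · simp [RationalFunction.degree]
    · simp [RationalFunction.eval]
  obtain ⟨a, b, g, hab, rfl, rfl⟩ := UniqueFactorizationMonoid.exists_reduced_factors P hP Q
  have hg : g ≠ 0 := left_ne_zero_of_mul hP
  have ha : a ≠ 0 := right_ne_zero_of_mul hP
  have hb : b ≠ 0 := by
    rintro rfl
    simpa using hQ 0
  have hgz : ∀ z, MvPolynomial.eval z g ≠ 0 := fun z h => by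
    have := hQ z
    rw [map_mul, h, zero_mul] at this
    exact this.false
  have hbz : ∀ z, MvPolynomial.eval z b ≠ 0 := fun z h => by
    have := hQ z
    rw [map_mul, h, mul_zero] at this
    exact this.false
  have hdeg : max a.totalDegree b.totalDegree ≤ max (g * a).totalDegree (g * b).totalDegree := by
    rw [totalDegree_mul_of_isDomain hg ha, totalDegree_mul_of_isDomain hg hb]
    exact max_le_max (Nat.le_add_left _ _) (Nat.le_add_left _ _)
  have hval : ∀ z, MvPolynomial.eval z a / MvPolynomial.eval z b =
      MvPolynomial.eval z (g * a) / MvPolynomial.eval z (g * b) + 0 := fun z => by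
    rw [map_mul, map_mul, mul_div_mul_left _ _ (hgz z), add_zero]
  -- the reduced denominator has no zeros, hence a constant sign
  by_cases hpos : ∀ z, 0 < MvPolynomial.eval z b
  · exact ⟨⟨a, b, ha, hpos, hab⟩, 0, by simpa using hη.le, hdeg, hval⟩
  · have hneg : ∀ z, MvPolynomial.eval z b < 0 := by
      push Not at hpos
      obtain ⟨z₀, hz₀⟩ := hpos
      intro z
      by_contra hz
      obtain ⟨y, hy⟩ := mem_range_of_exists_le_of_exists_ge
        (MvPolynomial.continuous_eval b) ⟨z₀, hz₀⟩ ⟨z, not_lt.1 hz⟩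
      exact hbz y hy
    refine ⟨⟨-a, -b, neg_ne_zero.2 ha, fun z => ?_, hab.neg_neg⟩, 0, by simpa using hη.le, ?_, ?_⟩
    · rw [map_neg]
      exact neg_pos.2 (hneg z)
    · simpa only [RationalFunction.degree, totalDegree_neg] using hdeg
    · intro z
      simp only [RationalFunction.eval, map_neg, neg_div_neg_eq]
      exact hval z

/-- The coordinate function `z ↦ z j`. -/
noncomputable def RationalFunction.coord {n : ℕ} (j : Fin n) : RationalFunction n where
  num := X j
  den := 1
  num_ne_zero := X_ne_zero j
  den_pos := by simp
  coprime := isRelPrime_one_right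

theorem RationalFunction.eval_coord {n : ℕ} (j : Fin n) (z : Fin n → ℝ) :
    (RationalFunction.coord j).eval z = z j := by
  simp [RationalFunction.coord, RationalFunction.eval]

theorem RationalFunction.degree_coord {n : ℕ} (j : Fin n) :
    (RationalFunction.coord j).degree = 1 := by
  simp [RationalFunction.coord, RationalFunction.degree]

theorem totalDegree_one_add_sq_pow_le {σ : Type} {q : MvPolynomial σ ℝ} (hq : q.totalDegree ≤ 1)
    (K : ℕ) : ((1 + q ^ 2) ^ K).totalDegree ≤ 2 * K := by
  refine (totalDegree_pow _ _).trans ?_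
  have h1 : (q ^ 2).totalDegree ≤ 2 := (totalDegree_pow _ _).trans (by omega)
  have h2 : (1 + q ^ 2).totalDegree ≤ 2 :=
    (totalDegree_add _ _).trans (by rw [totalDegree_one]; omega)
  rw [mul_comm]
  gcongr

theorem totalDegree_C_mul_X_le {σ : Type} (c : ℝ) (j : σ) :
    (C c * X j : MvPolynomial σ ℝ).totalDegree ≤ 1 := by
  refine (totalDegree_mul _ _).trans ?_
  rw [totalDegree_C, totalDegree_X]

/-- The function `z ↦ bump K (N * z j - l)`. -/
noncomputable def RationalFunction.shiftedBump {n : ℕ} (K N l : ℕ) (j : Fin n) :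
    RationalFunction n where
  num := 1
  den := (1 + (C (N : ℝ) * X j - C (l : ℝ)) ^ 2) ^ K
  num_ne_zero := one_ne_zero
  den_pos z := by
    simp only [map_pow, map_add, map_one, map_sub, map_mul, eval_C, eval_X]
    positivity
  coprime := isRelPrime_one_left

theorem RationalFunction.eval_shiftedBump {n : ℕ} (K N l : ℕ) (j : Fin n) (z : Fin n → ℝ) :
    (RationalFunction.shiftedBump K N l j).eval z = bump K (N * z j - l) := by
  simp [RationalFunction.shiftedBump, RationalFunction.eval, bump]

theorem RationalFunction.degree_shiftedBump_le {n : ℕ} (K N l : ℕ) (j : Fin n) :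
    (RationalFunction.shiftedBump K N l j).degree ≤ 2 * K := by
  refine max_le (by simp [RationalFunction.shiftedBump]) ?_
  exact totalDegree_one_add_sq_pow_le
    ((totalDegree_sub_C_le _ _).trans (totalDegree_C_mul_X_le _ _)) K

theorem RationalNetwork.output_le_width {m n : ℕ} (R : RationalNetwork m n) : n ≤ R.width := by
  cases R <;> exact le_max_right _ _

/-- Identity layers increase the depth without changing the function. -/
theorem RationalNetwork.exists_pad {m n : ℕ} (hn : 0 < n) (R : RationalNetwork m n) (k : ℕ) :
    ∃ R' : RationalNetwork m n, R'.eval = R.eval ∧ R'.depth = R.depth + k ∧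
      R'.width = R.width ∧ R'.degree ≤ max R.degree 1 := by
  induction k with
  | zero => exact ⟨R, rfl, rfl, rfl, le_max_left _ _⟩
  | succ k ih =>
    obtain ⟨R', h1, h2, h3, h4⟩ := ih
    refine ⟨.comp hn R' RationalFunction.coord, ?_, ?_, ?_, ?_⟩
    · ext z j
      change (RationalFunction.coord j).eval (R'.eval z) = R.eval z j
      rw [RationalFunction.eval_coord, h1]
    · rw [RationalNetwork.depth, h2, add_assoc]
    · rw [RationalNetwork.width, max_eq_left R'.output_le_width, h3]
    · rw [RationalNetwork.degree]
      refine max_le h4 (Finset.sup_le fun j _ => ?_)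
      rw [RationalFunction.degree_coord]
      exact le_max_right _ _

/-- The neurons of the first layer: one for each coordinate and each grid index, and one for each
coordinate that is passed on. -/
abbrev FirstLayerIndex (d N : ℕ) : Type := (Fin d × Fin (N + 1)) ⊕ Fin d

/-- The numbering of the neurons of the first layer. -/
def firstLayerEquiv (d N : ℕ) : FirstLayerIndex d N ≃ Fin (d * (N + 1) + d) :=
  (Equiv.sumCongr finProdFinEquiv (Equiv.refl _)).trans finSumFinEquiv

/-- The first layer computes the univariate bumps and passes on the coordinates. -/
noncomputable def firstLayer (K d N : ℕ) : Fin (d * (N + 1) + d) → RationalFunction d := fun a =>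
  Sum.elim (fun jl => RationalFunction.shiftedBump K N jl.2 jl.1) RationalFunction.coord
    ((firstLayerEquiv d N).symm a)

/-- The numerator of a weighted mean of the polynomials `P i`, as a polynomial in the outputs of
the first layer. -/
noncomputable def meanNum {d N : ℕ} (P : (Fin d → Fin (N + 1)) → MvPolynomial (Fin d) ℝ) :
    MvPolynomial (Fin (d * (N + 1) + d)) ℝ :=
  ∑ i, (∏ j, X (firstLayerEquiv d N (.inl (j, i j))) ^ 2) *
    rename (fun j => firstLayerEquiv d N (.inr j)) (P i)

/-- The sum of the weights, as a polynomial in the outputs of the first layer. The square added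
to the sum over the grid vanishes on these outputs, and it makes the polynomial positive at every
point. -/
noncomputable def meanDen (K d N : ℕ) : MvPolynomial (Fin (d * (N + 1) + d)) ℝ :=
  ∏ j, (∑ l, X (firstLayerEquiv d N (.inl (j, l))) ^ 2 +
    ((1 + (C (N : ℝ) * X (firstLayerEquiv d N (.inr j))) ^ 2) ^ K *
      X (firstLayerEquiv d N (.inl (j, 0))) - 1) ^ 2)

theorem firstLayer_eval_inl (K d N : ℕ) (j : Fin d) (l : Fin (N + 1)) (x : Fin d → ℝ) :
    (firstLayer K d N (firstLayerEquiv d N (.inl (j, l)))).eval x =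
      bump K (N * x j - (l : ℕ)) := by
  simp [firstLayer, RationalFunction.eval_shiftedBump]

theorem firstLayer_eval_inr (K d N : ℕ) (j : Fin d) (x : Fin d → ℝ) :
    (firstLayer K d N (firstLayerEquiv d N (.inr j))).eval x = x j := by
  simp [firstLayer, RationalFunction.eval_coord]

theorem firstLayer_degree_le {K : ℕ} (hK : 1 ≤ K) (d N : ℕ) (a : Fin (d * (N + 1) + d)) :
    (firstLayer K d N a).degree ≤ 2 * K := by
  obtain ⟨b, rfl⟩ := (firstLayerEquiv d N).surjective a
  rcases b with ⟨j, l⟩ | j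
  · simpa [firstLayer] using RationalFunction.degree_shiftedBump_le K N l j
  · simp only [firstLayer, Equiv.symm_apply_apply, Sum.elim_inr, RationalFunction.degree_coord]
    omega

theorem bump_sq (K : ℕ) (t : ℝ) : bump K t ^ 2 = bump (2 * K) t := by
  rw [bump, bump, inv_pow, ← pow_mul, mul_comm K]

theorem eval_meanNum (K : ℕ) {d N : ℕ} (P : (Fin d → Fin (N + 1)) → MvPolynomial (Fin d) ℝ)
    (x : Fin d → ℝ) :
    MvPolynomial.eval (fun a => (firstLayer K d N a).eval x) (meanNum P) =
      ∑ i, gridWeight (2 * K) N i x * MvPolynomial.eval x (P i) := by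
  simp only [meanNum, map_sum, map_mul, map_prod, map_pow, eval_X, eval_rename,
    firstLayer_eval_inl, bump_sq, gridWeight]
  refine Finset.sum_congr rfl fun i _ => ?_
  congr 3
  ext j
  exact firstLayer_eval_inr K d N j x

theorem eval_meanDen (K d N : ℕ) (x : Fin d → ℝ) :
    MvPolynomial.eval (fun a => (firstLayer K d N a).eval x) (meanDen K d N) =
      ∑ i : Fin d → Fin (N + 1), gridWeight (2 * K) N i x := by
  simp only [meanDen, map_prod, map_add, map_sum, map_sub, map_mul, map_one, map_pow, eval_X,
    eval_C, firstLayer_eval_inl, firstLayer_eval_inr, bump_sq, sum_gridWeight]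
  refine Finset.prod_congr rfl fun j _ => ?_
  have h : (1 + (N * x j) ^ 2) ^ K * bump K (N * x j - ((0 : Fin (N + 1)) : ℕ)) = 1 := by
    rw [bump, Fin.val_zero, Nat.cast_zero, sub_zero]
    exact mul_inv_cancel₀ (by positivity)
  rw [h]
  ring

theorem eval_meanDen_pos (K d N : ℕ) (z : Fin (d * (N + 1) + d) → ℝ) :
    0 < MvPolynomial.eval z (meanDen K d N) := by
  simp only [meanDen, map_prod, map_add, map_sum, map_sub, map_mul, map_one, map_pow, eval_X,
    eval_C]
  refine Finset.prod_pos fun j _ => ?_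
  have h0 : 0 ≤ ∑ l : Fin (N + 1), z (firstLayerEquiv d N (.inl (j, l))) ^ 2 :=
    Finset.sum_nonneg fun l _ => sq_nonneg _
  by_cases hz : z (firstLayerEquiv d N (.inl (j, 0))) = 0
  · rw [hz]
    norm_num
    linarith
  · have h1 : 0 < ∑ l : Fin (N + 1), z (firstLayerEquiv d N (.inl (j, l))) ^ 2 :=
      Finset.sum_pos' (fun l _ => sq_nonneg _) ⟨0, Finset.mem_univ _, by positivity⟩
    positivity

theorem totalDegree_meanNum_le {d N s : ℕ} {P : (Fin d → Fin (N + 1)) → MvPolynomial (Fin d) ℝ}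
    (hP : ∀ i, (P i).totalDegree ≤ s) : (meanNum P).totalDegree ≤ 2 * d + s := by
  refine totalDegree_finsetSum_le fun i _ => (totalDegree_mul _ _).trans ?_
  refine add_le_add ((totalDegree_finsetProd _ _).trans ?_)
    ((totalDegree_rename_le _ _).trans (hP i))
  simp [mul_comm]

theorem totalDegree_meanDen_le (K d N : ℕ) :
    (meanDen K d N).totalDegree ≤ d * (4 * K + 2) := by
  refine (totalDegree_finsetProd _ _).trans ?_
  refine (Finset.sum_le_card_nsmul _ _ (4 * K + 2) fun j _ => ?_).trans (by simp)
  refine (totalDegree_add _ _).trans (max_le ?_ ?_)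
  · refine totalDegree_finsetSum_le fun l _ => ?_
    rw [totalDegree_X_pow]
    omega
  · refine (totalDegree_pow _ _).trans ?_
    have h : ((1 + (C (N : ℝ) * X (firstLayerEquiv d N (.inr j))) ^ 2) ^ K *
        X (firstLayerEquiv d N (.inl (j, 0))) - 1 :
        MvPolynomial (Fin (d * (N + 1) + d)) ℝ).totalDegree ≤ 2 * K + 1 := by
      refine (totalDegree_sub_C_le _ 1).trans ((totalDegree_mul _ _).trans ?_)
      rw [totalDegree_X]
      exact add_le_add_left (totalDegree_one_add_sq_pow_le (totalDegree_C_mul_X_le _ _) K) 1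
    omega

end Networks

/-! ### The approximating networks -/

theorem cNorm_one_le {d p : ℕ} {g : (Fin d → ℝ) → (Fin p → ℝ)} {c : ℝ}
    (h0 : ∀ x ∈ unitCube d, ‖g x‖ ≤ c)
    (h1 : ∀ x ∈ unitCube d, ∃ D : (Fin d → ℝ) →L[ℝ] (Fin p → ℝ),
      HasFDerivWithinAt g D (unitCube d) x ∧ ‖D‖ ≤ c) :
    cNorm 1 g ≤ ENNReal.ofReal c := by
  refine iSup₂_le fun k hk => iSup_le fun i => iSup₂_le fun x hx => iSup_le fun m =>
    ENNReal.ofReal_le_ofReal ?_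
  rw [← Real.norm_eq_abs]
  refine (norm_le_pi_norm _ m).trans ?_
  rcases Nat.le_one_iff_eq_zero_or_eq_one.1 (Set.mem_Iic.1 hk) with rfl | rfl
  · simpa [partialDeriv] using h0 x hx
  · obtain ⟨D, hD, hDc⟩ := h1 x hx
    have hu := uniqueDiffOn_unitCube d x hx
    rw [partialDeriv, iteratedFDerivWithin_one_apply hu, hD.fderivWithin hu]
    refine (D.le_opNorm _).trans ?_
    rw [Pi.norm_single, norm_one, mul_one]
    exact hDc

theorem theorem3p2 (β : ℝ) (hβ : 2 < β) (p d : ℕ) (hp : 0 < p) (hd : 0 < d)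
    (ε : ℝ) (hε : 0 < ε) :
    ∃ C : ℝ, 0 < C ∧
      ∀ (f : (Fin d → ℝ) → (Fin p → ℝ)) (H : ℝ), 0 < H → f ∈ holderBall d p β H →
        ∃ c : ℝ, 0 < c ∧ ∃ R : ℕ → RationalNetwork d p, ∀ N : ℕ, 1 ≤ N →
          ((R N).width : ℝ) ≤ C * (N : ℝ) ∧
          (R N).depth = ⌊β⌋₊ + 2 ∧
          ((R N).degree : ℝ) ≤ C * (N : ℝ) ^ ε ∧
          cNorm 1 (fun x => f x - (R N).eval x) ≤
            ENNReal.ofReal (c * (N : ℝ) ^ (-(β - 1))) := by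
  -- `K` makes the weights decay fast enough, and `D` bounds the degrees in all layers
  set s := ⌊β⌋₊
  set K := s + 2 with hK
  set D := max (2 * K) (max (2 * d + s) (d * (4 * K + 2))) with hD
  refine ⟨((4 * d + p + D : ℕ) : ℝ), by exact_mod_cast (by omega), fun f H hH hf => ?_⟩
  obtain ⟨c, hc, happrox⟩ := exists_taylorMean_approx hβ hH.le hf (M := 2 * K) (by omega)
  refine ⟨c + 1, by positivity, ?_⟩
  suffices h : ∀ N : ℕ, ∃ R : RationalNetwork d p, 1 ≤ N →
      (R.width : ℝ) ≤ ((4 * d + p + D : ℕ) : ℝ) * (N : ℝ) ∧ R.depth = s + 2 ∧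
      (R.degree : ℝ) ≤ ((4 * d + p + D : ℕ) : ℝ) * (N : ℝ) ^ ε ∧
      cNorm 1 (fun x => f x - R.eval x) ≤ ENNReal.ofReal ((c + 1) * (N : ℝ) ^ (-(β - 1))) from
    Classical.skolem.1 h
  intro N
  -- nothing is claimed for `N = 0`, where any network will do
  rcases Nat.eq_zero_or_pos N with rfl | hN
  · exact ⟨.layer fun _ => RationalFunction.coord ⟨0, hd⟩, fun h => absurd h (by omega)⟩
  have hN0 : (0 : ℝ) < N := by exact_mod_cast hN
  have hη : 0 < (N : ℝ) ^ (-(β - 1)) := Real.rpow_pos_of_pos hN0 _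
  obtain ⟨P, hPdeg, g, hg, hgbound⟩ := happrox N hN
  choose r e he hrdeg hr using fun m : Fin p =>
    RationalFunction.exists_eval_eq_div_add (meanNum fun i => P i m) (meanDen (s + 2) d N)
      (eval_meanDen_pos (s + 2) d N) hη
  obtain ⟨R, hReval, hRdepth, hRwidth, hRdeg⟩ := RationalNetwork.exists_pad hp
    (.comp (by positivity) (.layer (firstLayer K d N)) r) s
  refine ⟨R, fun _ => ⟨?_, ?_, ?_, ?_⟩⟩
  · rw [hRwidth]
    simp only [RationalNetwork.width]
    have h1 : max (max d (d * (N + 1) + d)) p ≤ (4 * d + p + D) * N := by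
      have h2 : p ≤ p * N := Nat.le_mul_of_pos_right _ hN
      have h3 : d ≤ d * N := Nat.le_mul_of_pos_right _ hN
      have h4 : (4 * d + p + D) * N = 4 * (d * N) + p * N + D * N := by ring
      have h5 : d * (N + 1) = d * N + d := by ring
      rw [h4, h5]
      refine max_le (max_le ?_ ?_) ?_ <;> nlinarith [Nat.zero_le (D * N)]
    exact_mod_cast h1
  · rw [hRdepth]
    simp only [RationalNetwork.depth]
    omega
  · have h1 : R.degree ≤ D := by
      refine hRdeg.trans (max_le (max_le (Finset.sup_le fun a _ => ?_)
        (Finset.sup_le fun m _ => ?_)) (by omega))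
      · exact (firstLayer_degree_le (by omega) d N a).trans (le_max_left _ _)
      · exact (hrdeg m).trans ((max_le_max (totalDegree_meanNum_le fun i => hPdeg i m)
          (totalDegree_meanDen_le _ d N)).trans (le_max_right _ _))
    have h2 : (1 : ℝ) ≤ (N : ℝ) ^ ε := Real.one_le_rpow (by exact_mod_cast hN) hε.le
    calc (R.degree : ℝ) ≤ ((4 * d + p + D : ℕ) : ℝ) := by exact_mod_cast (by omega)
      _ ≤ _ := le_mul_of_one_le_right (by positivity) h2
  · -- on the cube, the error differs from `g` by a small constant
    have heq : Set.EqOn (fun x => f x - R.eval x) (fun x => g x - e) (unitCube d) := by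
      intro x hx
      ext m
      have h := hr m fun a => (firstLayer K d N a).eval x
      rw [eval_meanNum, eval_meanDen] at h
      simp only [Pi.sub_apply, hReval, RationalNetwork.eval, hg x hx m]
      rw [h]
      ring
    have he' : ‖e‖ ≤ (N : ℝ) ^ (-(β - 1)) := (pi_norm_le_iff_of_nonneg hη.le).2 he
    refine cNorm_one_le (fun x hx => ?_) fun x hx => ?_
    · refine (congrArg norm (heq hx)).trans_le ?_
      rw [add_mul, one_mul]
      exact (norm_sub_le _ _).trans (add_le_add (hgbound x hx).1 he')
    · obtain ⟨D', hD', hDle⟩ := (hgbound x hx).2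
      refine ⟨D', (hD'.sub_const e).congr heq (heq hx), hDle.trans ?_⟩
      gcongr
      linarith
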